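/- Let $\mathbb{K}$ be a field, let $d\in\mathbb{Z}$, and let $A=\mathbb{K}[u]$ be the polynomial algebra graded by $\deg(u)=d$, either over $\mathbb{Z}$ or, after reducing degrees modulo $2$, over $\mathbb{Z}/2\mathbb{Z}$. Regard $A$ as an $A_\infty$-algebra whose only nonzero operation is its product. For $G=\mathbb{Z}$ or $G=\mathbb{Z}/2\mathbb{Z}$, a $G$-graded right $A_\infty$-module over $A$ is a $G$-graded $\mathbb{K}$-vector space $\mathcal{M}$ with $\mathbb{K}$-multilinear operations $m_{k+1}\colon \mathcal{M}\otimes A^{\otimes k}\to\mathcal{M}$ of degree $1-k$ ($k\ge 0$) satisfying the $A_\infty$-module relations (no strict unitality is required). Its cohomology $H^*\mathcal{M}$ with respect to $m_1$ is a graded vector space with the right action of $A$ induced by $m_2$. A morphism $\mathcal{M}\to\mathcal{N}$ of $A_\infty$-modules is a sequence of multilinear maps $f_{k+1}\colon\mathcal{M}\otimes A^{\otimes k}\to\mathcal{N}$ of degree $-k$ ($k\geq 0$) satisfying the $A_\infty$-morphism relations; it is a quasi-isomorphism if $f_1$ induces an isomorphism on cohomology. A graded right $A$-module $M$ is an $A_\infty$-module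 with $m_2$ the action and $m_k=0$ for $k\neq 2$. Say that $M$ is intrinsically formal if every $G$-graded right $A_\infty$-module $\mathcal{M}$ over $A$ such that $H^*\mathcal{M}\cong M$ as graded right $A$-modules admits a quasi-isomorphism of $A_\infty$-modules $\mathcal{M}\to M$. Then every $\mathbb{Z}$-graded right $A$-module is intrinsically formal, and every $\mathbb{Z}/2\mathbb{Z}$-graded right $A$-module is intrinsically formal. -/

import Mathlib

open scoped DirectSum Polynomial

universe v w x

noncomputable section

/-- The grading on `K[u]` with `deg u = d`: the degree `g` part is spanned by the monomials `u ^ i`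
with `i • d = g`. -/
def polyGrading (K : Type*) [Field K] {G : Type*} [AddCommGroup G] (d : G) (g : G) :
    Submodule K K[X] where
  carrier := {p | ∀ i : ℕ, p.coeff i ≠ 0 → i • d = g}
  zero_mem' := fun i hi => absurd (Polynomial.coeff_zero i) hi
  add_mem' := by
    intro p q hp hq i hi
    by_cases h : p.coeff i = 0
    · exact hq i (by intro h'; exact hi (by simp [h, h']))
    · exact hp i h
  smul_mem' := by
    intro c p hp i hi
    exact hp i (by intro h; exact hi (by simp [h]))

/-- `K[u]` with `deg u = d` is a graded algebra. -/
instance polyGradedAlgebra (K : Type*) [Field K] {G : Type*} [AddCommGroup G] [DecidableEq G]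
    (d : G) : GradedAlgebra (polyGrading K d) :=
  haveI : SetLike.GradedMonoid (polyGrading K d) :=
    { one_mem := by
        intro i hi
        rw [Polynomial.coeff_one] at hi
        have : i = 0 := by by_contra h; exact hi (if_neg h)
        simp [this]
      mul_mem := by
        intro g h p q hp hq i hi
        rw [Polynomial.coeff_mul] at hi
        obtain ⟨⟨s, t⟩, hst, hne⟩ := Finset.exists_ne_zero_of_sum_ne_zero hi
        rw [Finset.HasAntidiagonal.mem_antidiagonal] at hst
        simp only at hst hne
        rw [← hst, add_smul, hp s (left_ne_zero_of_mul hne), hq t (right_ne_zero_of_mul hne)] }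
  have hX : (Polynomial.X : K[X]) ∈ polyGrading K d d := by
    intro i hi
    rw [Polynomial.coeff_X] at hi
    have : 1 = i := by by_contra h; exact hi (if_neg h)
    simp [← this]
  GradedAlgebra.ofAlgHom (polyGrading K d)
    (Polynomial.aeval (DirectSum.of (fun g => polyGrading K d g) d ⟨Polynomial.X, hX⟩))
    (by
      apply Polynomial.algHom_ext
      simp)
    (by
      rintro g ⟨p, hp⟩
      have key : ∀ (i : ℕ) (c : K) (hm : Polynomial.monomial i c ∈ polyGrading K d (i • d)),
          Polynomial.aeval (DirectSum.of (fun g => polyGrading K d g) d ⟨Polynomial.X, hX⟩)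
            (Polynomial.monomial i c)
            = DirectSum.of (fun g => polyGrading K d g) (i • d) ⟨Polynomial.monomial i c, hm⟩ := by
        intro i c hm
        rw [Polynomial.aeval_monomial, DirectSum.ofPow, DirectSum.algebraMap_apply,
          DirectSum.of_mul_of]
        apply DirectSum.of_eq_of_gradedMonoid_eq
        refine Sigma.subtype_ext (zero_add _) ?_
        simp [GradedMonoid.GMul.mul, GradedMonoid.mk, SetLike.coe_gnpow,
          Polynomial.C_mul_X_pow_eq_monomial, Polynomial.algebraMap_eq]
      have hmem : ∀ i ∈ p.support, Polynomial.monomial i (p.coeff i) ∈ polyGrading K d g := by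
        intro i hi j hj
        rw [Polynomial.coeff_monomial] at hj
        have : i = j := by by_contra h; exact hj (if_neg h)
        exact this ▸ hp i (Polynomial.mem_support_iff.mp hi)
      have hsum : (⟨p, hp⟩ : polyGrading K d g) =
          ∑ i ∈ p.support.attach, ⟨Polynomial.monomial i.1 (p.coeff i.1), hmem i.1 i.2⟩ := by
        apply Subtype.ext
        simp only [AddSubmonoidClass.coe_finsetSum]
        rw [Finset.sum_attach p.support (fun i => Polynomial.monomial i (p.coeff i))]
        exact p.as_sum_support
      rw [hsum, map_sum, AddSubmonoidClass.coe_finsetSum, map_sum]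
      refine Finset.sum_congr rfl fun i _ => ?_
      have hg : i.1 • d = g := hp i.1 (Polynomial.mem_support_iff.mp i.2)
      subst hg
      exact key _ _ _)

section Modules

variable {K : Type*} [Field K] {G : Type*} [AddCommGroupWithOne G] [DecidableEq G]
  {A : Type*} [Ring A] [Algebra K A]

/-- A `G`-graded (unital) right module over the graded `K`-algebra `A = ⨁ g, 𝒜 g`. -/
structure GradedRightModule (𝒜 : G → Submodule K A) [GradedAlgebra 𝒜] where
  carrier : Type v
  [addCommGroup : AddCommGroup carrier]
  [module : Module K carrier]
  [rightModule : Module Aᵐᵒᵖ carrier]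
  [isScalarTower : IsScalarTower K Aᵐᵒᵖ carrier]
  deg : G → Submodule K carrier
  isInternal : DirectSum.IsInternal deg
  smul_mem : ∀ {p q : G} {y : carrier} {a : A},
    y ∈ deg p → a ∈ 𝒜 q → MulOpposite.op a • y ∈ deg (p + q)

attribute [instance] GradedRightModule.addCommGroup GradedRightModule.module
  GradedRightModule.rightModule GradedRightModule.isScalarTower

/-- The sequence `a 0, …, a (r - 1), a r * a (r + 1), a (r + 2), …`. -/
def contractSeq (r : ℕ) (a : ℕ → A) : ℕ → A :=
  fun t => if t < r then a t else if t = r then a r * a (r + 1) else a (t + 1)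

/-- A `G`-graded right `A∞`-module over the graded algebra `A` (an `A∞`-algebra whose only operation
is its product). The operation `m k : M ⊗ A^{⊗ k} → M`, usually called `m_{k+1}` or `μ^{k+1}`, has
degree `1 - k`. The relations are the usual
`∑_{r+s+t=n} (-1)^{r+st} m_{r+1+t} (1^{⊗ r} ⊗ m_s ⊗ 1^{⊗ t}) = 0` with `n = k + 1`: the first sum
below collects the terms `r = 0` (`s = i + 1`, `t = j`), the second one the terms `r ≥ 1`, where
only `s = 2` contributes. No strict unitality is imposed. Inputs are sequences `a : ℕ → A` of which
only `a 0, …, a (k - 1)` are used. -/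
structure AInfModule (𝒜 : G → Submodule K A) [GradedAlgebra 𝒜] where
  carrier : Type v
  [addCommGroup : AddCommGroup carrier]
  [module : Module K carrier]
  deg : G → Submodule K carrier
  isInternal : DirectSum.IsInternal deg
  m : (k : ℕ) → carrier →ₗ[K] MultilinearMap K (fun _ : Fin k => A) carrier
  m_mem : ∀ (k : ℕ) (p : G) (q : Fin k → G) (y : carrier) (a : Fin k → A),
    y ∈ deg p → (∀ t, a t ∈ 𝒜 (q t)) → m k y a ∈ deg (p + ∑ t, q t + (1 - (k : G)))
  rel : ∀ (k : ℕ) (y : carrier) (a : ℕ → A),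
    ∑ ij ∈ Finset.HasAntidiagonal.antidiagonal k, (-1 : ℤ) ^ ((ij.1 + 1) * ij.2) •
        m ij.2 (m ij.1 y (fun t => a t)) (fun t => a (ij.1 + t))
      + ∑ r ∈ Finset.range (k - 1), (-1 : ℤ) ^ (r + 1) •
        m (k - 1) y (fun t => contractSeq r a t) = 0

attribute [instance] AInfModule.addCommGroup AInfModule.module

/-- A morphism of right `A∞`-modules: components `f k : M ⊗ A^{⊗ k} → N` (usually called `f_{k+1}`)
of degree `-k`, with
`∑_{r+s+t=n} (-1)^{r+st} f_{r+1+t} (1^{⊗ r} ⊗ m_s ⊗ 1^{⊗ t})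
  = ∑_{r+s=n} (-1)^{(r+1)s} m_{1+s} (f_r ⊗ 1^{⊗ s})` for `n = k + 1`. -/
structure AInfHom {𝒜 : G → Submodule K A} [GradedAlgebra 𝒜]
    (M : AInfModule.{v} 𝒜) (N : AInfModule.{w} 𝒜) where
  f : (k : ℕ) → M.carrier →ₗ[K] MultilinearMap K (fun _ : Fin k => A) N.carrier
  f_mem : ∀ (k : ℕ) (p : G) (q : Fin k → G) (y : M.carrier) (a : Fin k → A),
    y ∈ M.deg p → (∀ t, a t ∈ 𝒜 (q t)) → f k y a ∈ N.deg (p + ∑ t, q t - (k : G))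
  rel : ∀ (k : ℕ) (y : M.carrier) (a : ℕ → A),
    ∑ ij ∈ Finset.HasAntidiagonal.antidiagonal k, (-1 : ℤ) ^ ((ij.1 + 1) * ij.2) •
        f ij.2 (M.m ij.1 y (fun t => a t)) (fun t => a (ij.1 + t))
      + ∑ r ∈ Finset.range (k - 1), (-1 : ℤ) ^ (r + 1) •
        f (k - 1) y (fun t => contractSeq r a t)
    = ∑ ij ∈ Finset.HasAntidiagonal.antidiagonal k, (-1 : ℤ) ^ (ij.1 * ij.2) •
        N.m ij.2 (f ij.1 y (fun t => a t)) (fun t => a (ij.1 + t))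

namespace AInfModule

variable {𝒜 : G → Submodule K A} [GradedAlgebra 𝒜] (M : AInfModule.{v} 𝒜)

/-- The differential. -/
def d : M.carrier →ₗ[K] M.carrier where
  toFun y := M.m 0 y Fin.elim0
  map_add' y z := by simp
  map_smul' c y := by simp

/-- The binary operation `M ⊗ A → M` with fixed second input. -/
def act (a : A) : M.carrier →ₗ[K] M.carrier where
  toFun y := M.m 1 y (fun _ => a)
  map_add' y z := by simp
  map_smul' c y := by simp

theorem d_d (y : M.carrier) : M.d (M.d y) = 0 := by
  have h := M.rel 0 y (fun _ => 0)
  simp at h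
  have e : ∀ g : Fin 0 → A, g = Fin.elim0 := fun g => Subsingleton.elim _ _
  rw [e (fun _ => 0)] at h
  exact h

theorem d_act (a : A) (y : M.carrier) : M.d (M.act a y) = M.act a (M.d y) := by
  have h := M.rel 1 y (fun _ => a)
  simp [Finset.Nat.antidiagonal_succ] at h
  have e : ∀ g : Fin 0 → A, g = Fin.elim0 := fun g => Subsingleton.elim _ _
  rw [e (fun _ => a)] at h
  exact (neg_add_eq_zero.mp h).symm

/-- The cohomology `ker d / im d`. -/
abbrev Cohomology : Type v :=
  LinearMap.ker M.d ⧸ (LinearMap.range M.d).submoduleOf (LinearMap.ker M.d)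

/-- The degree `p` part of cohomology: classes represented by cocycles of degree `p`. -/
def cohDeg (p : G) : Submodule K M.Cohomology :=
  ((M.deg p).submoduleOf (LinearMap.ker M.d)).map
    ((LinearMap.range M.d).submoduleOf (LinearMap.ker M.d)).mkQ

/-- The right action of `a : A` on cohomology, `[y] · a = [m₂(y, a)]`. -/
def cohAct (a : A) : M.Cohomology →ₗ[K] M.Cohomology :=
  Submodule.mapQ _ _
    ((M.act a).restrict (p := LinearMap.ker M.d) (q := LinearMap.ker M.d) (by
      intro y hy
      rw [LinearMap.mem_ker] at hy ⊢
      rw [d_act, hy, map_zero]))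
    (by
      rintro ⟨y, hy⟩ ⟨z, hz⟩
      exact ⟨M.act a z, by rw [d_act, hz]; rfl⟩)

end AInfModule

namespace AInfHom

variable {𝒜 : G → Submodule K A} [GradedAlgebra 𝒜] {M : AInfModule.{v} 𝒜} {N : AInfModule.{w} 𝒜}
  (F : AInfHom M N)

/-- The underlying chain map. -/
def chainMap : M.carrier →ₗ[K] N.carrier where
  toFun y := F.f 0 y Fin.elim0
  map_add' y z := by simp
  map_smul' c y := by simp

theorem chainMap_d (y : M.carrier) : F.chainMap (M.d y) = N.d (F.chainMap y) := by
  have h := F.rel 0 y (fun _ => 0)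
  simp at h
  have e : ∀ g : Fin 0 → A, g = Fin.elim0 := fun g => Subsingleton.elim _ _
  rw [e (fun _ => 0)] at h
  exact h

/-- The map induced on cohomology. -/
def cohMap : M.Cohomology →ₗ[K] N.Cohomology :=
  Submodule.mapQ _ _
    (F.chainMap.restrict (p := LinearMap.ker M.d) (q := LinearMap.ker N.d) (by
      intro y hy
      rw [LinearMap.mem_ker] at hy ⊢
      rw [← chainMap_d, hy, map_zero]))
    (by
      rintro ⟨y, hy⟩ ⟨z, hz⟩
      exact ⟨F.chainMap z, by rw [← chainMap_d, hz]; rfl⟩)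

/-- A quasi-isomorphism of `A∞`-modules. -/
def IsQuasiIso : Prop := Function.Bijective F.cohMap

end AInfHom

/-- `M` is quasi-isomorphic to `N`: some morphism of `A∞`-modules `M → N` is a
quasi-isomorphism. -/
def AInfModule.QuasiIsomorphic {𝒜 : G → Submodule K A} [GradedAlgebra 𝒜]
    (M : AInfModule.{v} 𝒜) (N : AInfModule.{w} 𝒜) : Prop :=
  ∃ F : AInfHom M N, F.IsQuasiIso

namespace GradedRightModule

variable {𝒜 : G → Submodule K A} [GradedAlgebra 𝒜] (M : GradedRightModule.{v} 𝒜)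

/-- The action `M ⊗ A → M`, as an operation with one algebra input. -/
def actMap : M.carrier →ₗ[K] MultilinearMap K (fun _ : Fin 1 => A) M.carrier where
  toFun y :=
    { toFun := fun a => MulOpposite.op (a 0) • y
      map_update_add' := by
        intro _ a t b c
        obtain rfl : t = 0 := Subsingleton.elim _ _
        simp [add_smul]
      map_update_smul' := by
        intro _ a t c b
        obtain rfl : t = 0 := Subsingleton.elim _ _
        simp }
  map_add' y z := by ext a; simp
  map_smul' c y := by
    ext a
    simp only [MultilinearMap.coe_mk, smul_apply, RingHom.id_apply]
    rw [← algebraMap_smul Aᵐᵒᵖ c y, ← algebraMap_smul Aᵐᵒᵖ c (MulOpposite.op (a 0) • y),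
      smul_smul, smul_smul, Algebra.commutes]

/-- The operations of a graded right module, seen as an `A∞`-module: only `M ⊗ A → M` is nonzero. -/
def ops : (k : ℕ) → M.carrier →ₗ[K] MultilinearMap K (fun _ : Fin k => A) M.carrier
  | 1 => M.actMap
  | _ => 0

/-- A graded right module as an `A∞`-module with trivial differential and higher operations. -/
def toAInf : AInfModule.{v} 𝒜 where
  carrier := M.carrier
  deg := M.deg
  isInternal := M.isInternal
  m := M.ops
  m_mem := by
    intro k p q y a hy ha
    rcases k with _ | _ | k
    · exact Submodule.zero_mem _
    · have h := M.smul_mem hy (ha 0)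
      simpa [ops, actMap] using h
    · exact Submodule.zero_mem _
  rel := by
    intro k y a
    rcases k with _ | _ | _ | k
    · simp [ops]
    · simp [ops, Finset.Nat.antidiagonal_succ]
    · simp [ops, actMap, contractSeq, Finset.Nat.antidiagonal_succ, smul_smul]
    · rw [Finset.sum_eq_zero, Finset.sum_eq_zero, add_zero]
      · intro r _
        simp [ops]
      · rintro ⟨i, j⟩ hij
        rw [Finset.HasAntidiagonal.mem_antidiagonal] at hij
        rcases i with _ | _ | i
        · simp [ops]
        · have : j = k + 2 := by simp at hij; omega
          subst this
          simp [ops]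
        · simp [ops]

/-- The cohomology of the `A∞`-module `N` is isomorphic to `M` as a graded right `A`-module. -/
def IsoCohomology (N : AInfModule.{w} 𝒜) : Prop :=
  ∃ e : N.Cohomology ≃ₗ[K] M.carrier,
    (∀ p : G, (N.cohDeg p).map e.toLinearMap = M.deg p) ∧
    ∀ (h : N.Cohomology) (a : A), e (N.cohAct a h) = MulOpposite.op a • e h

/-- `M` is intrinsically formal: every graded right `A∞`-module whose cohomology is isomorphic to
`M` is quasi-isomorphic to `M`. -/
def IntrinsicallyFormal : Prop :=
  ∀ N : AInfModule.{w} 𝒜, M.IsoCohomology N → N.QuasiIsomorphic M.toAInf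

end GradedRightModule

end Modules

end

/-!
Write `A = K[u]`. An `A∞`-morphism from `N` to an honest module `M` is the same as an `A`-linear
chain map from the bar resolution `⨁ k, N ⊗ A^{⊗ k} ⊗ A` to `M`; the components of the morphism
are, up to sign, the values at `1` in the last factor. Such a map is found because `A` is
hereditary, and in the case of a polynomial ring in one variable it can be written down.

Choose a linear map `π : N → M` of degree `0` that sends a cocycle to its class in `H(N) ≅ M`
(`exists_linear_data`). Composing the augmentation `(y; a, p) ↦ m(y; a, p)` of the bar resolution
with `π` gives a chain map, which need not be linear over `u`. For a cocycle `w` of `N`,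
however, `π (w · u) = π (w) u`, whence `π (w · u) - π (w) u = α (d w)` for some
`α : N → M`. The augmentation is linear over `u` up to the homotopy `m(y; a, p, u)`
(`AInfModule.snocInput_op_mul`). Together these show that the failure of `π m` to be linear over
`u` is the differential `D ψ` of an explicit family `ψ` (`resDiff_defectSeq`). The bar
resolution is free over `K[u]`, so there is a family `θ`
with `θ (p u) = θ(p) u + ψ(p)` and `θ(1) = 0` (`integrate`). As `D` commutes with the action of
`u`, the map `π m - D θ` is linear over `K[u]` (`linearized_eq`), and evaluating it at `1` gives
the morphism `formalityMap`. Its relations (`barDiff_formalityMap`) are checked separately on the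
parts coming from `π m` and from `θ`, which avoids any use of `D ∘ D = 0`.

On a cocycle `y` the first component is the class of `y · 1`, that is, the class of `y`, because
`1` acts as the identity on `H(N) ≅ M`; so the morphism is a quasi-isomorphism.
-/

noncomputable section

/-! ### Differentials of the bar construction and the bar resolution -/

section Bar

variable {K : Type*} [Field K] {G : Type*} [AddCommGroupWithOne G] [DecidableEq G]
  {A : Type*} [Ring A] [Algebra K A]

theorem contractSeq_congr {n r : ℕ} {a b : ℕ → A} (h : ∀ t < n, a t = b t) {t : ℕ}
    (ht : t + 1 < n) : contractSeq r a t = contractSeq r b t := by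
  unfold contractSeq
  split_ifs with h1 h2
  · exact h t (by omega)
  · rw [h r (by omega), h (r + 1) (by omega)]
  · exact h _ ht

theorem neg_one_zpow_eq_of_even_add {m n : ℕ} (h : Even (m + n)) : (-1 : ℤ) ^ m = (-1) ^ n := by
  have h1 : (-1 : ℤ) ^ m * (-1) ^ n = 1 := by rw [← pow_add, h.neg_one_pow]
  rcases neg_one_pow_eq_or ℤ n with h2 | h2 <;> rw [h2] at h1 ⊢ <;> linarith

/-- A family of functions of sequences is local if its `k`-th member only sees the first `k`
entries. -/
def IsLocal {A Y E : Type*} (g : ℕ → Y → (ℕ → A) → E) : Prop :=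
  ∀ k y (a b : ℕ → A), (∀ t < k, a t = b t) → g k y a = g k y b

/-- Insert `p` as the last of the inputs of `g (k + 1)`. -/
def snocInput {A Y E : Type*} (g : ℕ → Y → (ℕ → A) → E) : ℕ → Y → (ℕ → A) → A → E :=
  fun k y a p => g (k + 1) y (Function.update a k p)

theorem isLocal_snocInput {A Y E : Type*} {g : ℕ → Y → (ℕ → A) → E} (hg : IsLocal g) :
    IsLocal (snocInput g) := by
  intro k y a b h
  funext p
  refine hg _ _ _ _ fun t ht => ?_
  by_cases e : t = k
  · simp [e]
  · simp [e, h t (by omega)]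

theorem IsLocal.contractSeq_last {Y E : Type*} {g : ℕ → Y → (ℕ → A) → E} (hg : IsLocal g) (k : ℕ)
    (y : Y) (a : ℕ → A) :
    g (k + 1) y (contractSeq k a) = snocInput g k y a (a k * a (k + 1)) := by
  refine hg _ _ _ _ fun t ht => ?_
  by_cases e : t = k
  · simp [e, contractSeq]
  · simp [e, contractSeq, show t < k by omega]

theorem snocInput_contractSeq {Y E : Type*} (g : ℕ → Y → (ℕ → A) → E) {k r : ℕ} (hr : r < k)
    (y : Y) (a : ℕ → A) :
    snocInput g k y (contractSeq r a) (a (k + 1)) = g (k + 1) y (contractSeq r a) := by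
  unfold snocInput
  congr 1
  rw [Function.update_eq_self_iff]
  simp [contractSeq, show ¬ k < r by omega, show k ≠ r by omega]

namespace AInfModule

variable {𝒜 : G → Submodule K A} [GradedAlgebra 𝒜] (N : AInfModule.{w} 𝒜)
  {E E' : Type*} [AddCommGroup E] [AddCommGroup E']

/-- The operation `m k` evaluated on the first `k` entries of a sequence. -/
def op (k : ℕ) (y : N.carrier) (a : ℕ → A) : N.carrier := N.m k y (fun t => a t)

theorem isLocal_op : IsLocal N.op := by
  intro k y a b h
  unfold op
  congr 1
  funext t
  exact h t t.2

/-- Precomposition of a family `g k : N ⊗ A^{⊗ k} → E` with the differential of the bar construction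
of `N`. -/
def barDiff (g : ℕ → N.carrier → (ℕ → A) → E) (k : ℕ) (y : N.carrier) (a : ℕ → A) : E :=
  ∑ ij ∈ Finset.HasAntidiagonal.antidiagonal k, (-1 : ℤ) ^ ((ij.1 + 1) * ij.2) •
      g ij.2 (N.op ij.1 y a) (fun t => a (ij.1 + t))
    + ∑ r ∈ Finset.range (k - 1), (-1 : ℤ) ^ (r + 1) • g (k - 1) y (contractSeq r a)

/-- Precomposition of a family `g k : N ⊗ A^{⊗ k} ⊗ A → E` with the differential of the bar
resolution `⨁ k, N ⊗ A^{⊗ k} ⊗ A`. In contrast to `barDiff`, no operation of `N` consumes the last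
input. -/
def resDiff (g : ℕ → N.carrier → (ℕ → A) → A → E) (k : ℕ) (y : N.carrier) (a : ℕ → A) (p : A) : E :=
  ∑ ij ∈ Finset.HasAntidiagonal.antidiagonal k, (-1 : ℤ) ^ ((ij.1 + 1) * (ij.2 + 1)) •
      g ij.2 (N.op ij.1 y a) (fun t => a (ij.1 + t)) p
    + ∑ r ∈ Finset.range (k - 1), (-1 : ℤ) ^ (r + 1) • g (k - 1) y (contractSeq r a) p
    + if k = 0 then 0 else (-1 : ℤ) ^ k • g (k - 1) y a (a (k - 1) * p)

theorem barDiff_op (k : ℕ) (y : N.carrier) (a : ℕ → A) : N.barDiff N.op k y a = 0 :=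
  N.rel k y a

/-- The `k`-th entry of the sequence is not an input of `resDiff g k`. -/
theorem resDiff_update {g : ℕ → N.carrier → (ℕ → A) → A → E} (hg : IsLocal g) (k : ℕ)
    (y : N.carrier) (a : ℕ → A) (p q : A) :
    N.resDiff g k y (Function.update a k q) p = N.resDiff g k y a p := by
  have hu : ∀ t < k, Function.update a k q t = a t := fun t ht => by simp [ht.ne]
  unfold resDiff
  congr 1
  · congr 1
    · refine Finset.sum_congr rfl ?_
      rintro ⟨i, j⟩ hij
      rw [Finset.HasAntidiagonal.mem_antidiagonal] at hij
      simp only at hij ⊢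
      rw [N.isLocal_op i y _ a fun t ht => hu t (by omega),
        hg j _ _ (fun t => a (i + t)) fun t ht => hu _ (by omega)]
    · refine Finset.sum_congr rfl fun r hr => ?_
      rw [hg (k - 1) y _ (contractSeq r a) fun t ht => contractSeq_congr hu (by omega)]
  · split_ifs with hk
    · rfl
    · rw [hg (k - 1) y _ a fun t ht => hu t (by omega), hu _ (by omega)]

/-- The differential of the bar construction is that of the bar resolution together with the one
term in which all inputs are consumed by an operation of `N`. -/
theorem barDiff_succ {g : ℕ → N.carrier → (ℕ → A) → E} (hg : IsLocal g) (k : ℕ) (y : N.carrier)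
    (a : ℕ → A) :
    N.barDiff g (k + 1) y a = N.resDiff (snocInput g) k y a (a k)
      + g 0 (N.op (k + 1) y a) (fun t => a (k + 1 + t)) := by
  have h1 : ∀ ij ∈ Finset.HasAntidiagonal.antidiagonal k,
      (-1 : ℤ) ^ ((ij.1 + 1) * (ij.2 + 1)) •
        snocInput g ij.2 (N.op ij.1 y a) (fun t => a (ij.1 + t)) (a k)
        = (-1 : ℤ) ^ ((ij.1 + 1) * (ij.2 + 1)) •
          g (ij.2 + 1) (N.op ij.1 y a) (fun t => a (ij.1 + t)) := by
    rintro ⟨i, j⟩ hij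
    rw [Finset.HasAntidiagonal.mem_antidiagonal] at hij
    simp only [snocInput] at hij ⊢
    congr 2
    rw [Function.update_eq_self_iff, hij]
  have h2 : ∀ r ∈ Finset.range (k - 1), (-1 : ℤ) ^ (r + 1) •
      snocInput g (k - 1) y (contractSeq r a) (a k)
        = (-1 : ℤ) ^ (r + 1) • g k y (contractSeq r a) := by
    intro r hr
    rw [Finset.mem_range] at hr
    obtain ⟨k, rfl⟩ : ∃ l, k = l + 1 := ⟨k - 1, by omega⟩
    simp only [Nat.add_sub_cancel] at hr ⊢
    rw [snocInput_contractSeq g hr]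
  unfold barDiff resDiff
  rw [Finset.sum_congr rfl h1, Finset.sum_congr rfl h2, Finset.Nat.antidiagonal_succ',
    Finset.sum_cons, Finset.sum_map]
  simp only [Function.Embedding.prodMap, Function.Embedding.coeFn_mk, Prod.map, mul_zero, pow_zero,
    one_smul, Function.Embedding.refl_apply, Nat.succ_eq_add_one]
  rcases k with _ | k
  · simp [add_comm]
  · simp only [Nat.add_sub_cancel, Nat.add_eq_zero_iff, one_ne_zero, and_false, if_false]
    rw [Finset.sum_range_succ, hg.contractSeq_last]
    abel

/-- Separating the last two inputs: `q` is substituted for the last one, and the sign `(-1) ^ j`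
turns the sum into `resDiff` with respect to the last but one. -/
theorem resDiff_succ {g : ℕ → N.carrier → (ℕ → A) → A → E} (hg : IsLocal g) (k : ℕ) (y : N.carrier)
    (a : ℕ → A) (q : A) :
    N.resDiff g (k + 1) y a q =
      (-1 : ℤ) ^ (k + 1) • N.resDiff
          (fun j y a p => (-1 : ℤ) ^ j • snocInput g j y a p q) k y a (a k)
        + (-1 : ℤ) ^ k • g 0 (N.op (k + 1) y a) (fun t => a (k + 1 + t)) q
        + (-1 : ℤ) ^ (k + 1) • g k y a (a k * q) := by
  have h1 : ∀ ij ∈ Finset.HasAntidiagonal.antidiagonal k,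
      (-1 : ℤ) ^ (k + 1) • (-1 : ℤ) ^ ((ij.1 + 1) * (ij.2 + 1)) • (-1 : ℤ) ^ ij.2 •
        snocInput g ij.2 (N.op ij.1 y a) (fun t => a (ij.1 + t)) (a k) q
        = (-1 : ℤ) ^ ((ij.1 + 1) * (ij.2 + 1 + 1)) •
          g (ij.2 + 1) (N.op ij.1 y a) (fun t => a (ij.1 + t)) q := by
    rintro ⟨i, j⟩ hij
    rw [Finset.HasAntidiagonal.mem_antidiagonal] at hij
    simp only [snocInput] at hij ⊢
    rw [smul_smul, smul_smul, ← pow_add, ← pow_add]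
    congr 1
    · refine neg_one_zpow_eq_of_even_add ⟨(i + 1) * (j + 1) + i + j + 1, ?_⟩
      rw [← hij]
      ring
    · congr 1
      rw [Function.update_eq_self_iff, hij]
  have h2 : ∀ r ∈ Finset.range (k - 1),
      (-1 : ℤ) ^ (k + 1) • (-1 : ℤ) ^ (r + 1) • (-1 : ℤ) ^ (k - 1) •
        snocInput g (k - 1) y (contractSeq r a) (a k) q
        = (-1 : ℤ) ^ (r + 1) • g k y (contractSeq r a) q := by
    intro r hr
    rw [Finset.mem_range] at hr
    obtain ⟨k, rfl⟩ : ∃ l, k = l + 1 := ⟨k - 1, by omega⟩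
    simp only [Nat.add_sub_cancel] at hr ⊢
    rw [snocInput_contractSeq g hr, smul_smul, smul_smul, ← pow_add, ← pow_add]
    congr 1
    exact neg_one_zpow_eq_of_even_add ⟨k + 1 + r + 1, by ring⟩
  unfold resDiff
  rw [smul_add, smul_add, Finset.smul_sum, Finset.smul_sum, Finset.sum_congr rfl h1,
    Finset.sum_congr rfl h2]
  rw [Finset.Nat.antidiagonal_succ', Finset.sum_cons, Finset.sum_map]
  simp only [Function.Embedding.prodMap, Function.Embedding.coeFn_mk, Prod.map,
    Function.Embedding.refl_apply, Nat.succ_eq_add_one, Nat.add_sub_cancel, zero_add, mul_one,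
    Nat.add_eq_zero_iff, one_ne_zero, and_false, if_false]
  have h3 : (-1 : ℤ) ^ (k + 1 + 1) = (-1 : ℤ) ^ k := by ring
  rw [h3]
  rcases k with _ | k
  · simp [add_comm]
  · simp only [Nat.add_sub_cancel, Nat.add_eq_zero_iff, one_ne_zero, and_false, if_false]
    rw [Finset.sum_range_succ, hg.contractSeq_last, smul_smul, smul_smul,
      ← pow_add, ← pow_add,
      neg_one_zpow_eq_of_even_add (m := k + 1 + 1 + (k + 1) + k) (n := k + 1)
        ⟨2 * k + 2, by ring⟩]
    abel

theorem barDiff_add (g h : ℕ → N.carrier → (ℕ → A) → E) (k : ℕ) (y : N.carrier) (a : ℕ → A) :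
    N.barDiff (fun k y a => g k y a + h k y a) k y a = N.barDiff g k y a + N.barDiff h k y a := by
  simp only [barDiff, smul_add, Finset.sum_add_distrib]
  abel

theorem resDiff_add (g h : ℕ → N.carrier → (ℕ → A) → A → E) (k : ℕ) (y : N.carrier) (a : ℕ → A)
    (p : A) :
    N.resDiff (fun k y a p => g k y a p + h k y a p) k y a p
      = N.resDiff g k y a p + N.resDiff h k y a p := by
  unfold resDiff
  split_ifs
  · simp only [smul_add, Finset.sum_add_distrib]
    abel
  · simp only [smul_add, Finset.sum_add_distrib]
    abel

theorem resDiff_map {F : Type*} [FunLike F E E'] [AddMonoidHomClass F E E'] (φ : F)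
    (g : ℕ → N.carrier → (ℕ → A) → A → E) (k : ℕ) (y : N.carrier) (a : ℕ → A) (p : A) :
    N.resDiff (fun k y a p => φ (g k y a p)) k y a p = φ (N.resDiff g k y a p) := by
  simp only [resDiff, map_add, map_sum, map_zsmul, apply_ite φ, map_zero]

theorem resDiff_neg (g : ℕ → N.carrier → (ℕ → A) → A → E) (k : ℕ) (y : N.carrier) (a : ℕ → A)
    (p : A) : N.resDiff (fun k y a p => -g k y a p) k y a p = -N.resDiff g k y a p :=
  N.resDiff_map (-AddMonoidHom.id E) g k y a p

/-- The differential of the bar resolution commutes with the right action of `A` on the last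
tensor factor. -/
theorem resDiff_mul_right (g : ℕ → N.carrier → (ℕ → A) → A → E) (k : ℕ) (y : N.carrier)
    (a : ℕ → A) (p q : A) :
    N.resDiff (fun k y a p => g k y a (p * q)) k y a p = N.resDiff g k y a (p * q) := by
  simp only [resDiff, mul_assoc]

/-- Setting the last input to `1`: the terms of `resDiff` form, up to the sign twist `(-1) ^ k`, the
differential `barDiff`, except for the product of the last two inputs. -/
theorem resDiff_one (g : ℕ → N.carrier → (ℕ → A) → A → E) (k : ℕ) (y : N.carrier) (a : ℕ → A) :
    N.resDiff g k y a 1 =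
      (-1 : ℤ) ^ (k + 1) • N.barDiff (fun k y a => (-1 : ℤ) ^ k • g k y a 1) k y a
      + if k = 0 then 0 else (-1 : ℤ) ^ k • g (k - 1) y a (a (k - 1)) := by
  have h1 : ∀ ij ∈ Finset.HasAntidiagonal.antidiagonal k,
      (-1 : ℤ) ^ (k + 1) • (-1 : ℤ) ^ ((ij.1 + 1) * ij.2) • (-1 : ℤ) ^ ij.2 •
        g ij.2 (N.op ij.1 y a) (fun t => a (ij.1 + t)) 1
        = (-1 : ℤ) ^ ((ij.1 + 1) * (ij.2 + 1)) •
          g ij.2 (N.op ij.1 y a) (fun t => a (ij.1 + t)) 1 := by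
    rintro ⟨i, j⟩ hij
    rw [Finset.HasAntidiagonal.mem_antidiagonal] at hij
    simp only at hij ⊢
    rw [smul_smul, smul_smul, ← pow_add, ← pow_add]
    congr 1
    refine neg_one_zpow_eq_of_even_add ⟨(i + 1) * (j + 1) + j, ?_⟩
    rw [← hij]
    ring
  have h2 : ∀ r ∈ Finset.range (k - 1),
      (-1 : ℤ) ^ (k + 1) • (-1 : ℤ) ^ (r + 1) • (-1 : ℤ) ^ (k - 1) •
        g (k - 1) y (contractSeq r a) 1
        = (-1 : ℤ) ^ (r + 1) • g (k - 1) y (contractSeq r a) 1 := by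
    intro r hr
    rw [Finset.mem_range] at hr
    obtain ⟨k, rfl⟩ : ∃ l, k = l + 1 := ⟨k - 1, by omega⟩
    simp only [Nat.add_sub_cancel] at hr ⊢
    rw [smul_smul, smul_smul, ← pow_add, ← pow_add]
    congr 1
    exact neg_one_zpow_eq_of_even_add ⟨k + 1 + r + 1, by ring⟩
  unfold resDiff barDiff
  rw [smul_add, Finset.smul_sum, Finset.smul_sum, Finset.sum_congr rfl h1,
    Finset.sum_congr rfl h2, mul_one]

/-- The augmentation `N ⊗ A^{⊗ k} ⊗ A → N` given by the operations of `N` anticommutes with the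
differentials. -/
theorem resDiff_snocInput_op (k : ℕ) (y : N.carrier) (a : ℕ → A) (p : A) :
    N.resDiff (snocInput N.op) k y a p = -N.d (snocInput N.op k y a p) := by
  have h := N.barDiff_op (k + 1) y (Function.update a k p)
  rw [N.barDiff_succ N.isLocal_op, Function.update_self,
    N.resDiff_update (isLocal_snocInput N.isLocal_op)] at h
  refine (eq_neg_of_add_eq_zero_left h).trans ?_
  congr 1
  exact congrArg (N.m 0 _) (Subsingleton.elim _ _)

/-- The augmentation `N ⊗ A^{⊗ k} ⊗ A → N`, given by the operations of `N`, commutes with the right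
action of `q` up to homotopy. -/
theorem snocInput_op_mul (k : ℕ) (y : N.carrier) (a : ℕ → A) (p q : A) :
    snocInput N.op k y a (p * q) = N.act q (snocInput N.op k y a p)
      - N.resDiff (fun j y a p => (-1 : ℤ) ^ j • snocInput (snocInput N.op) j y a p q) k y a p
      + (-1 : ℤ) ^ k • N.d (snocInput (snocInput N.op) k y a p q) := by
  have hl := isLocal_snocInput N.isLocal_op
  have hl2 : IsLocal (fun j y a p => (-1 : ℤ) ^ j • snocInput (snocInput N.op) j y a p q) := by
    intro k y a b h
    funext p
    simp only [isLocal_snocInput hl k y a b h]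
  have h := N.resDiff_succ hl k y (Function.update a k p) q
  rw [Function.update_self, N.resDiff_update hl2, resDiff_snocInput_op] at h
  have e1 : snocInput N.op k y (Function.update a k p) (p * q) = snocInput N.op k y a (p * q) := by
    simp [snocInput]
  have e2 : ∀ (w : N.carrier) (b : ℕ → A), snocInput N.op 0 w b q = N.act q w := by
    intro w b
    refine congrArg (N.m 1 w) ?_
    funext t
    simp
  have e3 : (-1 : ℤ) ^ k * (-1 : ℤ) ^ k = 1 := by rw [← pow_add, Even.neg_one_pow ⟨k, rfl⟩]
  rw [e1, e2] at h
  have h' := congrArg (fun z => (-1 : ℤ) ^ k • z) h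
  simp only [smul_add, smul_smul, pow_succ, mul_neg, mul_one, e3, neg_smul, one_smul,
    smul_neg] at h'
  change -((-1 : ℤ) ^ k • N.d (snocInput (snocInput N.op) k y a p q)) =
    -_ + N.act q (snocInput N.op k y a p) + -_ at h'
  rw [← sub_eq_zero] at h' ⊢
  rw [← h']
  abel

end AInfModule

end Bar

/-! ### Families of multilinear maps -/

section Multilinear

variable {K A Y E E' : Type*} [Field K] [Ring A] [Algebra K A] [AddCommGroup Y] [Module K Y]
  [AddCommGroup E] [Module K E] [AddCommGroup E'] [Module K E']

/-- Postcomposition of a family of multilinear maps with a linear map. -/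
def postcomp {k : ℕ} (φ : E →ₗ[K] E') (f : Y →ₗ[K] MultilinearMap K (fun _ : Fin k => A) E) :
    Y →ₗ[K] MultilinearMap K (fun _ : Fin k => A) E' :=
  (φ.compMultilinearMapₗ K) ∘ₗ f

/-- Separate the last algebra input. -/
def curryLast {k : ℕ} (f : Y →ₗ[K] MultilinearMap K (fun _ : Fin (k + 1) => A) E) :
    Y →ₗ[K] MultilinearMap K (fun _ : Fin k => A) (A →ₗ[K] E) :=
  (multilinearCurryRightEquiv K (fun _ : Fin (k + 1) => A) E).toLinearMap ∘ₗ f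

/-- The inverse of `curryLast`. -/
def uncurryLast {k : ℕ} (f : Y →ₗ[K] MultilinearMap K (fun _ : Fin k => A) (A →ₗ[K] E)) :
    Y →ₗ[K] MultilinearMap K (fun _ : Fin (k + 1) => A) E :=
  (multilinearCurryRightEquiv K (fun _ : Fin (k + 1) => A) E).symm.toLinearMap ∘ₗ f

/-- Substitute `q` for the last algebra input. -/
def evalLast {k : ℕ} (q : A) (f : Y →ₗ[K] MultilinearMap K (fun _ : Fin (k + 1) => A) E) :
    Y →ₗ[K] MultilinearMap K (fun _ : Fin k => A) E :=
  postcomp (LinearMap.applyₗ q) (curryLast f)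

@[simp]
theorem curryLast_apply {k : ℕ} (f : Y →ₗ[K] MultilinearMap K (fun _ : Fin (k + 1) => A) E) (y : Y)
    (a : Fin k → A) (p : A) : curryLast f y a p = f y (Fin.snoc a p) := rfl

theorem snoc_seq {A : Type*} (k : ℕ) (a : ℕ → A) (p : A) :
    (Fin.snoc (fun t : Fin k => a t) p : Fin (k + 1) → A)
      = fun t : Fin (k + 1) => Function.update a k p t := by
  funext t
  refine Fin.lastCases ?_ (fun t => ?_) t
  · simp
  · simp [t.2.ne]

end Multilinear

/-! ### Graded right modules over `K[u]` -/

namespace GradedRightModule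

variable {K : Type*} [Field K] {G : Type*} [AddCommGroupWithOne G] [DecidableEq G]
  {A : Type*} [Ring A] [Algebra K A] {𝒜 : G → Submodule K A} [GradedAlgebra 𝒜]
  (M : GradedRightModule.{v} 𝒜)

/-- Right multiplication by `a` as a linear map. -/
def rmul (a : A) : M.carrier →ₗ[K] M.carrier where
  toFun y := MulOpposite.op a • y
  map_add' := smul_add _
  map_smul' c y := congrArg (fun g => g (fun _ : Fin 1 => a)) (M.actMap.map_smul c y)

theorem rmul_apply (a : A) (y : M.carrier) : M.rmul a y = MulOpposite.op a • y := rfl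

theorem ops_of_ne_one {k : ℕ} (hk : k ≠ 1) (y : M.carrier) (a : Fin k → A) :
    M.ops k y a = 0 := by
  rcases k with _ | _ | k
  · rfl
  · exact absurd rfl hk
  · rfl

theorem rmul_mul (a b : A) (y : M.carrier) : M.rmul (a * b) y = M.rmul b (M.rmul a y) := by
  simp only [rmul_apply, MulOpposite.op_mul, mul_smul]

theorem rmul_one (y : M.carrier) : M.rmul 1 y = y := by
  simp only [rmul_apply, MulOpposite.op_one, one_smul]

theorem rmul_add (a b : A) (y : M.carrier) : M.rmul (a + b) y = M.rmul a y + M.rmul b y := by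
  simp only [rmul_apply, MulOpposite.op_add, add_smul]

theorem rmul_algebraMap (c : K) (y : M.carrier) : M.rmul (algebraMap K A c) y = c • y := by
  exact algebraMap_smul Aᵐᵒᵖ c y

/-- Only `m₂` contributes to the right-hand side of the relations of a morphism into `M`. -/
theorem sum_ops (f : ℕ → M.carrier) (k : ℕ) (a : ℕ → A) :
    ∑ ij ∈ Finset.HasAntidiagonal.antidiagonal k, (-1 : ℤ) ^ (ij.1 * ij.2) •
        M.ops ij.2 (f ij.1) (fun t => a (ij.1 + t))
      = if k = 0 then 0 else (-1 : ℤ) ^ (k - 1) • M.rmul (a (k - 1)) (f (k - 1)) := by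
  have h0 : ∀ ij : ℕ × ℕ, ij.2 ≠ 1 → (-1 : ℤ) ^ (ij.1 * ij.2) •
      M.ops ij.2 (f ij.1) (fun t => a (ij.1 + t)) = 0 := fun ij h => by
    rw [ops_of_ne_one M h, smul_zero]
  rcases k with _ | k
  · rw [if_pos rfl]
    refine Finset.sum_eq_zero fun ij hij => h0 ij ?_
    rw [Finset.HasAntidiagonal.mem_antidiagonal] at hij
    omega
  · rw [Finset.sum_eq_single (k, 1)]
    · simp only [mul_one, if_neg (Nat.succ_ne_zero k)]
      rfl
    · rintro ⟨i, j⟩ hij hne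
      rw [Finset.HasAntidiagonal.mem_antidiagonal] at hij
      refine h0 _ fun h => hne ?_
      simp only at hij h
      rw [h, Prod.mk.injEq]
      omega
    · intro h
      rw [Finset.HasAntidiagonal.mem_antidiagonal] at h
      exact absurd rfl h

end GradedRightModule

section Polynomial

variable {K : Type*} [Field K] {G : Type*} [AddCommGroupWithOne G] [DecidableEq G] {d : G}

namespace GradedRightModule

variable (M : GradedRightModule.{v} (polyGrading K d))

/-- The linear map `θ` with `θ 1 = 0` and `θ (p u) = θ p u + ψ p`. -/
def integrate : (K[X] →ₗ[K] M.carrier) →ₗ[K] (K[X] →ₗ[K] M.carrier) where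
  toFun ψ := (Polynomial.basisMonomials K).constr K fun n =>
    ∑ i ∈ Finset.range n, M.rmul (Polynomial.X ^ (n - 1 - i)) (ψ (Polynomial.X ^ i))
  map_add' φ ψ := by
    refine (Polynomial.basisMonomials K).ext fun n => ?_
    rw [LinearMap.add_apply]
    simp only [Module.Basis.constr_basis, LinearMap.add_apply, map_add, Finset.sum_add_distrib]
  map_smul' c ψ := by
    refine (Polynomial.basisMonomials K).ext fun n => ?_
    rw [LinearMap.smul_apply]
    simp only [Module.Basis.constr_basis, LinearMap.smul_apply, Finset.smul_sum, RingHom.id_apply,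
      map_smul]

theorem integrate_X_pow (ψ : K[X] →ₗ[K] M.carrier) (n : ℕ) :
    M.integrate ψ (Polynomial.X ^ n) =
      ∑ i ∈ Finset.range n, M.rmul (Polynomial.X ^ (n - 1 - i)) (ψ (Polynomial.X ^ i)) := by
  rw [← Polynomial.monomial_one_right_eq_X_pow]
  exact (Polynomial.basisMonomials K).constr_basis K (fun n =>
    ∑ i ∈ Finset.range n, M.rmul (Polynomial.X ^ (n - 1 - i)) (ψ (Polynomial.X ^ i))) n

@[simp]
theorem integrate_one (ψ : K[X] →ₗ[K] M.carrier) : M.integrate ψ 1 = 0 := by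
  simpa using M.integrate_X_pow ψ 0

/-- Freeness of `K[u]` over `u`: every prescribed failure `ψ` of linearity is attained. -/
theorem integrate_mul_X (ψ : K[X] →ₗ[K] M.carrier) (p : K[X]) :
    M.integrate ψ (p * Polynomial.X) = M.rmul Polynomial.X (M.integrate ψ p) + ψ p := by
  suffices h : M.integrate ψ ∘ₗ LinearMap.mulRight K Polynomial.X
      = M.rmul Polynomial.X ∘ₗ M.integrate ψ + ψ from LinearMap.congr_fun h p
  refine (Polynomial.basisMonomials K).ext fun n => ?_
  simp only [Polynomial.coe_basisMonomials, Polynomial.monomial_one_right_eq_X_pow,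
    LinearMap.comp_apply, LinearMap.mulRight_apply, LinearMap.add_apply, ← pow_succ,
    integrate_X_pow]
  rw [Finset.sum_range_succ, map_sum]
  congr 1
  · refine Finset.sum_congr rfl fun i hi => ?_
    rw [Finset.mem_range] at hi
    rw [← rmul_mul, ← pow_succ]
    congr 3
    omega
  · rw [Nat.add_sub_cancel, Nat.sub_self, pow_zero, rmul_one]

/-- If `ψ` raises degrees by `c + d`, then `integrate ψ` raises degrees by `c`. -/
theorem integrate_mem {ψ : K[X] →ₗ[K] M.carrier} {c : G}
    (hψ : ∀ q, ∀ p ∈ polyGrading K d q, ψ p ∈ M.deg (c + q + d)) {q : G} {p : K[X]}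
    (hp : p ∈ polyGrading K d q) : M.integrate ψ p ∈ M.deg (c + q) := by
  have hX : ∀ n : ℕ, (Polynomial.X ^ n : K[X]) ∈ polyGrading K d (n • d) := by
    intro n i hi
    rw [Polynomial.coeff_X_pow] at hi
    rw [of_not_not fun h => hi (if_neg h)]
  rw [p.as_sum_support_C_mul_X_pow, map_sum]
  refine Submodule.sum_mem _ fun n hn => ?_
  rw [← Polynomial.smul_eq_C_mul, map_smul, integrate_X_pow]
  refine Submodule.smul_mem _ _ (Submodule.sum_mem _ fun i hi => ?_)
  rw [Finset.mem_range] at hi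
  have h := M.smul_mem (hψ _ _ (hX i)) (hX (n - 1 - i))
  have hq : n • d = q := hp n (Polynomial.mem_support_iff.1 hn)
  have e : c + i • d + d + (n - 1 - i) • d = c + q := by
    rw [← hq]
    obtain ⟨m, rfl⟩ : ∃ m, n = i + 1 + m := ⟨n - 1 - i, by omega⟩
    rw [show i + 1 + m - 1 - i = m by omega, add_smul, add_smul, one_smul]
    abel
  rwa [e] at h

end GradedRightModule

end Polynomial

/-! ### The explicit morphism -/

section Formality

variable {K : Type*} [Field K] {G : Type*} [AddCommGroupWithOne G] [DecidableEq G] {d : G}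

namespace GradedRightModule

variable (M : GradedRightModule.{v} (polyGrading K d)) (N : AInfModule.{w} (polyGrading K d))
  (π α : N.carrier →ₗ[K] M.carrier)

/-- The family `ψ k (y; a, p) = -(α m(y; a, p) + (-1) ^ k π m(y; a, p, u))`. Its differential is the
failure of `π m(y; a, p)` to be linear over `u` in `p`, see `resDiff_defectSeq`. -/
def defect (k : ℕ) : N.carrier →ₗ[K] MultilinearMap K (fun _ : Fin (k + 1) => K[X]) M.carrier :=
  -(postcomp α (N.m (k + 1))
    + (-1 : ℤ) ^ k • postcomp π (evalLast (Polynomial.X : K[X]) (N.m (k + 2))))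

/-- The family `θ k (y; a, p)` obtained from `defect` by solving `θ (p u) = θ(p) u + ψ(p)` in the
last input. -/
def correction (k : ℕ) : N.carrier →ₗ[K] MultilinearMap K (fun _ : Fin (k + 1) => K[X]) M.carrier :=
  uncurryLast (postcomp M.integrate (curryLast (defect M N π α k)))

/-- The components of a morphism of `A∞`-modules `N → M`:
`f 0 (y) = π m(y, 1)` and `f (k + 1) (y; a, p) = (-1) ^ (k + 1) π m(y; a, p, 1) - θ k (y; a, p)`. -/
def formalityMap : (k : ℕ) → N.carrier →ₗ[K] MultilinearMap K (fun _ : Fin k => K[X]) M.carrier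
  | 0 => postcomp π (evalLast (1 : K[X]) (N.m 1))
  | k + 1 => (-1 : ℤ) ^ (k + 1) • postcomp π (evalLast (1 : K[X]) (N.m (k + 2)))
      - correction M N π α k

/-- `defect` on the first `k` entries of a sequence, as a linear map of the last input. -/
def defectSeq (k : ℕ) (y : N.carrier) (a : ℕ → K[X]) : K[X] →ₗ[K] M.carrier :=
  curryLast (defect M N π α k) y (fun t => a t)

/-- `correction` on the first `k` entries of a sequence, as a linear map of the last input. -/
def correctionSeq (k : ℕ) (y : N.carrier) (a : ℕ → K[X]) : K[X] →ₗ[K] M.carrier :=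
  M.integrate (defectSeq M N π α k y a)

theorem defectSeq_apply (k : ℕ) (y : N.carrier) (a : ℕ → K[X]) (p : K[X]) :
    defectSeq M N π α k y a p = -(α (snocInput N.op k y a p)
      + (-1 : ℤ) ^ k • π (snocInput (snocInput N.op) k y a p Polynomial.X)) := by
  have h : defectSeq M N π α k y a p = -(α (N.m (k + 1) y (Fin.snoc (fun t : Fin k => a t) p))
      + (-1 : ℤ) ^ k • π (N.m (k + 2) y (Fin.snoc (Fin.snoc (fun t : Fin k => a t) p :
        Fin (k + 1) → K[X]) Polynomial.X))) := rfl
  rw [h, snoc_seq, snoc_seq]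
  rfl

theorem isLocal_correctionSeq : IsLocal (correctionSeq M N π α) := by
  intro k y a b h
  have : (fun t : Fin k => a t) = fun t : Fin k => b t := funext fun t => h t t.2
  rw [correctionSeq, correctionSeq, defectSeq, defectSeq, this]

theorem formalityMap_zero (y : N.carrier) (a : Fin 0 → K[X]) :
    formalityMap M N π α 0 y a = π (N.act 1 y) := by
  have h : formalityMap M N π α 0 y a = π (N.m 1 y (Fin.snoc a 1)) := rfl
  rw [h]
  congr 2

theorem formalityMap_seq (k : ℕ) (y : N.carrier) (a : ℕ → K[X]) :
    formalityMap M N π α k y (fun t => a t) = (-1 : ℤ) ^ k • π (snocInput N.op k y a 1)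
      + if k = 0 then 0 else -correctionSeq M N π α (k - 1) y a (a (k - 1)) := by
  rcases k with _ | k
  · have h : formalityMap M N π α 0 y (fun t => a t)
        = π (N.m 1 y (Fin.snoc (fun t : Fin 0 => a t) 1)) := rfl
    rw [h, snoc_seq, if_pos rfl, add_zero, pow_zero, one_smul]
    rfl
  · have h : formalityMap M N π α (k + 1) y (fun t => a t)
        = (-1 : ℤ) ^ (k + 1) • π (N.m (k + 2) y (Fin.snoc (fun t : Fin (k + 1) => a t) 1))
          - correctionSeq M N π α k y a (a k) := rfl
    rw [h, snoc_seq, if_neg (Nat.succ_ne_zero k), Nat.add_sub_cancel, sub_eq_add_neg]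
    rfl

/-- The map `π m - D θ` on the bar resolution, where `D` is precomposition with the differential. It
is linear over `K[u]` in the last factor, see `linearized_eq`. -/
def linearized (k : ℕ) (y : N.carrier) (a : ℕ → K[X]) (p : K[X]) : M.carrier :=
  π (snocInput N.op k y a p) - N.resDiff (fun k y a p => correctionSeq M N π α k y a p) k y a p

variable {M N π α}

theorem resDiff_defectSeq
    (hα : ∀ y, π (N.act Polynomial.X y) - M.rmul Polynomial.X (π y) = α (N.d y))
    (hπ : ∀ y, π (N.d y) = 0) (k : ℕ) (y : N.carrier) (a : ℕ → K[X]) (p : K[X]) :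
    N.resDiff (fun k y a p => defectSeq M N π α k y a p) k y a p
      = π (snocInput N.op k y a (p * Polynomial.X))
        - M.rmul Polynomial.X (π (snocInput N.op k y a p)) := by
  have h : N.resDiff (fun k y a p => defectSeq M N π α k y a p) k y a p
      = -(α (N.resDiff (snocInput N.op) k y a p) + π (N.resDiff (fun k y a p =>
        (-1 : ℤ) ^ k • snocInput (snocInput N.op) k y a p Polynomial.X) k y a p)) := by
    simp only [defectSeq_apply, ← map_zsmul]
    rw [N.resDiff_neg, N.resDiff_add, N.resDiff_map α, N.resDiff_map π]
  rw [h, N.resDiff_snocInput_op, N.snocInput_op_mul, map_add, map_sub, map_zsmul, hπ, smul_zero,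
    map_neg, ← hα]
  abel

theorem linearized_mul_X
    (hα : ∀ y, π (N.act Polynomial.X y) - M.rmul Polynomial.X (π y) = α (N.d y))
    (hπ : ∀ y, π (N.d y) = 0) (k : ℕ) (y : N.carrier) (a : ℕ → K[X]) (p : K[X]) :
    linearized M N π α k y a (p * Polynomial.X)
      = M.rmul Polynomial.X (linearized M N π α k y a p) := by
  unfold linearized
  rw [← N.resDiff_mul_right]
  simp only [correctionSeq, integrate_mul_X]
  rw [N.resDiff_add, N.resDiff_map (M.rmul Polynomial.X),
    resDiff_defectSeq hα hπ, map_sub]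
  abel

theorem linearized_add (k : ℕ) (y : N.carrier) (a : ℕ → K[X]) (p q : K[X]) :
    linearized M N π α k y a (p + q)
      = linearized M N π α k y a p + linearized M N π α k y a q := by
  have h : N.resDiff (fun k y a p => correctionSeq M N π α k y a p) k y a (p + q)
      = N.resDiff (fun k y a p => correctionSeq M N π α k y a p) k y a p
        + N.resDiff (fun k y a p => correctionSeq M N π α k y a p) k y a q := by
    simp only [AInfModule.resDiff, mul_add, map_add, smul_add, Finset.sum_add_distrib]
    split_ifs <;> abel
  have h' : snocInput N.op k y a (p + q) = snocInput N.op k y a p + snocInput N.op k y a q := by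
    have e : ∀ p, snocInput N.op k y a p = curryLast (N.m (k + 1)) y (fun t => a t) p := by
      intro p
      rw [curryLast_apply, snoc_seq]
      rfl
    rw [e, e, e, map_add]
  unfold linearized
  rw [h, h', map_add]
  abel

theorem linearized_smul (k : ℕ) (y : N.carrier) (a : ℕ → K[X]) (c : K) (p : K[X]) :
    linearized M N π α k y a (c • p) = c • linearized M N π α k y a p := by
  have h : N.resDiff (fun k y a p => correctionSeq M N π α k y a p) k y a (c • p)
      = c • N.resDiff (fun k y a p => correctionSeq M N π α k y a p) k y a p := by
    simp only [AInfModule.resDiff, mul_smul_comm, map_smul, smul_add, Finset.smul_sum, smul_ite,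
      smul_zero, smul_comm c]
  have h' : snocInput N.op k y a (c • p) = c • snocInput N.op k y a p := by
    have e : ∀ p, snocInput N.op k y a p = curryLast (N.m (k + 1)) y (fun t => a t) p := by
      intro p
      rw [curryLast_apply, snoc_seq]
      rfl
    rw [e, e, map_smul]
  unfold linearized
  rw [h, h', map_smul, smul_sub]

theorem linearized_eq
    (hα : ∀ y, π (N.act Polynomial.X y) - M.rmul Polynomial.X (π y) = α (N.d y))
    (hπ : ∀ y, π (N.d y) = 0) (k : ℕ) (y : N.carrier) (a : ℕ → K[X]) (p : K[X]) :
    linearized M N π α k y a p = M.rmul p (linearized M N π α k y a 1) := by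
  induction p using Polynomial.induction_on with
  | C c =>
    rw [← Polynomial.algebraMap_eq, rmul_algebraMap, Algebra.algebraMap_eq_smul_one,
      linearized_smul]
  | add p q hp hq => rw [linearized_add, rmul_add, hp, hq]
  | monomial n c h =>
    rw [pow_succ, ← mul_assoc, linearized_mul_X hα hπ, h, ← rmul_mul]

theorem formalityMap_eq_linearized (k : ℕ) (y : N.carrier) (a : ℕ → K[X]) :
    formalityMap M N π α k y (fun t => a t) = (-1 : ℤ) ^ k • linearized M N π α k y a 1 := by
  have h : N.resDiff (fun k y a p => correctionSeq M N π α k y a p) k y a 1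
      = if k = 0 then 0
        else (-1 : ℤ) ^ k • correctionSeq M N π α (k - 1) y a (a (k - 1)) := by
    simp only [AInfModule.resDiff, correctionSeq, integrate_one, smul_zero, Finset.sum_const_zero,
      zero_add, mul_one]
  have e3 : (-1 : ℤ) ^ k * (-1 : ℤ) ^ k = 1 := by rw [← pow_add, Even.neg_one_pow ⟨k, rfl⟩]
  rw [formalityMap_seq, linearized, smul_sub, h, sub_eq_add_neg]
  congr 1
  split_ifs
  · simp
  · rw [smul_smul, e3, one_smul]

theorem barDiff_snocInput_one (hπ : ∀ y, π (N.d y) = 0) (k : ℕ) (y : N.carrier) (a : ℕ → K[X]) :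
    N.barDiff (fun k y a => (-1 : ℤ) ^ k • π (snocInput N.op k y a 1)) k y a
      = if k = 0 then 0 else π (N.op k y a) := by
  have h := N.resDiff_map π (snocInput N.op) k y a 1
  rw [N.resDiff_snocInput_op, N.resDiff_one] at h
  simp only [map_neg, hπ, neg_zero] at h
  have e3 : (-1 : ℤ) ^ (k + 1) * (-1 : ℤ) ^ (k + 1) = 1 := by
    rw [← pow_add, Even.neg_one_pow ⟨k + 1, rfl⟩]
  have h' := congrArg (fun z => (-1 : ℤ) ^ (k + 1) • z) h
  simp only [smul_add, smul_smul, e3, one_smul, smul_zero] at h'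
  rw [eq_neg_of_add_eq_zero_left h']
  rcases k with _ | k
  · simp
  · rw [if_neg (Nat.succ_ne_zero k), if_neg (Nat.succ_ne_zero k), smul_smul, ← pow_add,
      Odd.neg_one_pow ⟨k + 1, by ring⟩, neg_smul, one_smul, neg_neg, Nat.add_sub_cancel]
    simp [snocInput]

theorem barDiff_correctionSeq (k : ℕ) (y : N.carrier) (a : ℕ → K[X]) :
    N.barDiff (fun k y a => if k = 0 then 0
        else -correctionSeq M N π α (k - 1) y a (a (k - 1))) k y a
      = if k = 0 then 0
        else -N.resDiff (fun k y a p => correctionSeq M N π α k y a p) (k - 1) y a (a (k - 1)) := by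
  have hl := isLocal_correctionSeq M N π α
  rcases k with _ | k
  · simp [AInfModule.barDiff]
  · rw [N.barDiff_succ, if_pos rfl, add_zero, if_neg (Nat.succ_ne_zero k), Nat.add_sub_cancel]
    · rw [← N.resDiff_neg]
      congr 1
      funext k y a p
      have h := hl k y (Function.update a k p) a fun t ht => by
        rw [Function.update_of_ne ht.ne]
      rw [snocInput, if_neg (Nat.succ_ne_zero k), Nat.add_sub_cancel, Function.update_self, h]
    · intro k y a b h
      rcases k with _ | k
      · rfl
      · simp only [if_neg (Nat.succ_ne_zero k), Nat.add_sub_cancel]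
        rw [h k (by omega), hl k y a b fun t ht => h t (by omega)]

/-- The relations of a morphism of `A∞`-modules hold for `formalityMap`. -/
theorem barDiff_formalityMap
    (hα : ∀ y, π (N.act Polynomial.X y) - M.rmul Polynomial.X (π y) = α (N.d y))
    (hπ : ∀ y, π (N.d y) = 0) (k : ℕ) (y : N.carrier) (a : ℕ → K[X]) :
    N.barDiff (fun k y a => formalityMap M N π α k y (fun t => a t)) k y a
      = if k = 0 then 0 else (-1 : ℤ) ^ (k - 1) •
        M.rmul (a (k - 1)) (formalityMap M N π α (k - 1) y (fun t => a t)) := by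
  simp only [formalityMap_seq]
  rw [N.barDiff_add, barDiff_snocInput_one hπ, barDiff_correctionSeq]
  rcases k with _ | k
  · simp
  · rw [← formalityMap_seq, formalityMap_eq_linearized]
    have e3 : (-1 : ℤ) ^ k * (-1 : ℤ) ^ k = 1 := by rw [← pow_add, Even.neg_one_pow ⟨k, rfl⟩]
    simp only [if_neg (Nat.succ_ne_zero k), Nat.add_sub_cancel]
    rw [map_zsmul, smul_smul, e3, one_smul, ← linearized_eq hα hπ, linearized, sub_eq_add_neg]
    simp [snocInput]

end GradedRightModule

end Formality

/-! ### Homogeneous linear maps -/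

section Graded

variable {K V W ι : Type*} [Field K] [AddCommGroup V] [Module K V] [AddCommGroup W] [Module K W]

theorem LinearMap.exists_comp_eq_of_ker_le {V' : Type*} [AddCommGroup V'] [Module K V']
    (f : V →ₗ[K] V') (g : V →ₗ[K] W) (h : LinearMap.ker f ≤ LinearMap.ker g) :
    ∃ φ : V' →ₗ[K] W, ∀ y, φ (f y) = g y := by
  obtain ⟨φ, hφ⟩ := LinearMap.exists_extend
    ((LinearMap.ker f).liftQ g h ∘ₗ f.quotKerEquivRange.symm.toLinearMap)
  refine ⟨φ, fun y => ?_⟩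
  have e := LinearMap.congr_fun hφ ⟨f y, LinearMap.mem_range_self f y⟩
  simp only [LinearMap.comp_apply, Submodule.subtype_apply, LinearEquiv.coe_coe,
    LinearMap.quotKerEquivRange_symm_apply_image, Submodule.mkQ_apply, Submodule.liftQ_apply] at e
  exact e

variable [AddCommGroup ι] [DecidableEq ι] {𝒱 : ι → Submodule K V} {𝒲 : ι → Submodule K W}

/-- The component of degree `c` of a linear map between graded spaces: it agrees with the map
wherever the map already has degree `c`. -/
theorem DirectSum.IsInternal.exists_homogeneous (h𝒱 : DirectSum.IsInternal 𝒱)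
    (h𝒲 : DirectSum.IsInternal 𝒲) (T : V →ₗ[K] W) (c : ι) :
    ∃ T' : V →ₗ[K] W, (∀ p, ∀ y ∈ 𝒱 p, T' y ∈ 𝒲 (p + c)) ∧
      ∀ p, ∀ y ∈ 𝒱 p, T y ∈ 𝒲 (p + c) → T' y = T y := by
  let := h𝒱.chooseDecomposition
  let := h𝒲.chooseDecomposition
  let T' : V →ₗ[K] W := DirectSum.toModule K ι W (fun p => (𝒲 (p + c)).subtype ∘ₗ
    DirectSum.component K ι (fun i => 𝒲 i) (p + c) ∘ₗ
    (DirectSum.decomposeLinearEquiv 𝒲).toLinearMap ∘ₗ T ∘ₗ (𝒱 p).subtype) ∘ₗ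
    (DirectSum.decomposeLinearEquiv 𝒱).toLinearMap
  have hT' : ∀ p, ∀ y ∈ 𝒱 p, T' y = DirectSum.decompose 𝒲 (T y) (p + c) := by
    intro p y hy
    simp only [T', LinearMap.comp_apply, LinearEquiv.coe_coe,
      DirectSum.decomposeLinearEquiv_apply]
    rw [DirectSum.decompose_of_mem 𝒱 hy, ← DirectSum.lof_eq_of K, DirectSum.toModule_lof]
    rfl
  refine ⟨T', fun p y hy => ?_, fun p y hy h => ?_⟩
  · rw [hT' p y hy]
    exact SetLike.coe_mem _
  · rw [hT' p y hy, DirectSum.decompose_of_mem_same 𝒲 h]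

/-- The kernel of a homogeneous linear map is a graded subspace. -/
theorem DirectSum.IsInternal.ker_le_iSup (h𝒱 : DirectSum.IsInternal 𝒱) (h𝒲 : DirectSum.IsInternal 𝒲)
    {T : V →ₗ[K] W} {c : ι} (hT : ∀ p, ∀ y ∈ 𝒱 p, T y ∈ 𝒲 (p + c)) :
    LinearMap.ker T ≤ ⨆ p, LinearMap.ker T ⊓ 𝒱 p := by
  classical
  let := h𝒱.chooseDecomposition
  let := h𝒲.chooseDecomposition
  have key : ∀ (y : V) (p : ι),
      (DirectSum.decompose 𝒲 (T y) (p + c) : W) = T (DirectSum.decompose 𝒱 y p) := by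
    intro y p
    induction y using DirectSum.Decomposition.inductionOn 𝒱 with
    | zero => simp
    | @homogeneous i y =>
      by_cases h : i = p
      · subst h
        rw [DirectSum.decompose_of_mem_same 𝒱 y.2, DirectSum.decompose_of_mem_same 𝒲 (hT _ _ y.2)]
      · rw [DirectSum.decompose_of_mem_ne 𝒱 y.2 h, map_zero,
          DirectSum.decompose_of_mem_ne 𝒲 (hT _ _ y.2) fun e => h (add_right_cancel e)]
    | add y z hy hz => simp [hy, hz]
  intro z hz
  rw [LinearMap.mem_ker] at hz
  rw [← DirectSum.sum_support_decompose 𝒱 z]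
  refine Submodule.sum_mem _ fun p _ => Submodule.mem_iSup_of_mem p ⟨?_, SetLike.coe_mem _⟩
  rw [SetLike.mem_coe, LinearMap.mem_ker, ← key, hz]
  simp

end Graded

/-! ### Degrees and the quasi-isomorphism -/

theorem X_mem_polyGrading {K : Type*} [Field K] {G : Type*} [AddCommGroup G] {d : G} :
    (Polynomial.X : K[X]) ∈ polyGrading K d d := by
  intro i hi
  rw [Polynomial.coeff_X] at hi
  rw [← of_not_not fun h => hi (if_neg h), one_smul]

section Formality

variable {K : Type*} [Field K] {G : Type*} [AddCommGroupWithOne G] [DecidableEq G] {d : G}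

namespace GradedRightModule

variable {M : GradedRightModule.{v} (polyGrading K d)} {N : AInfModule.{w} (polyGrading K d)}
  {π α : N.carrier →ₗ[K] M.carrier}

/-- The degree of `m (k + 1)` when its last input `r` has degree `e`. -/
theorem evalLast_m_mem {e : G} {r : K[X]} (hr : r ∈ polyGrading K d e) {k : ℕ} {p : G}
    {q : Fin k → G} {y : N.carrier} {a : Fin k → K[X]} (hy : y ∈ N.deg p)
    (ha : ∀ t, a t ∈ polyGrading K d (q t)) :
    N.m (k + 1) y (Fin.snoc a r) ∈ N.deg (p + ∑ t, q t + e - (k : G)) := by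
  have h := N.m_mem (k + 1) p (Fin.snoc q e) y (Fin.snoc a r) hy fun t => by
    refine Fin.lastCases ?_ (fun t => ?_) t
    · simpa using hr
    · simpa using ha t
  rw [Fin.sum_univ_castSucc] at h
  simp only [Fin.snoc_castSucc, Fin.snoc_last] at h
  convert h using 1
  push_cast
  abel_nf

theorem defect_mem (hπ : ∀ p, ∀ y ∈ N.deg p, π y ∈ M.deg p)
    (hα : ∀ p, ∀ y ∈ N.deg p, α y ∈ M.deg (p + (d - 1))) {k : ℕ} {p : G}
    {q : Fin (k + 1) → G} {y : N.carrier} {a : Fin (k + 1) → K[X]} (hy : y ∈ N.deg p)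
    (ha : ∀ t, a t ∈ polyGrading K d (q t)) :
    defect M N π α k y a ∈ M.deg (p + ∑ t, q t + d - ((k + 1 : ℕ) : G)) := by
  have h1 := hα _ _ (N.m_mem (k + 1) p q y a hy ha)
  have h2 := hπ _ _ (evalLast_m_mem X_mem_polyGrading hy ha)
  have e : p + ∑ t, q t + (1 - ((k + 1 : ℕ) : G)) + (d - 1)
      = p + ∑ t, q t + d - ((k + 1 : ℕ) : G) := by abel
  rw [e] at h1
  exact Submodule.neg_mem _ (Submodule.add_mem _ h1 (zsmul_mem h2 _))

theorem correction_mem (hπ : ∀ p, ∀ y ∈ N.deg p, π y ∈ M.deg p)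
    (hα : ∀ p, ∀ y ∈ N.deg p, α y ∈ M.deg (p + (d - 1))) {k : ℕ} {p : G}
    {q : Fin (k + 1) → G} {y : N.carrier} {a : Fin (k + 1) → K[X]} (hy : y ∈ N.deg p)
    (ha : ∀ t, a t ∈ polyGrading K d (q t)) :
    correction M N π α k y a ∈ M.deg (p + ∑ t, q t - ((k + 1 : ℕ) : G)) := by
  have h := M.integrate_mem (ψ := curryLast (defect M N π α k) y fun t => a t.castSucc)
    (c := p + ∑ t : Fin k, q t.castSucc - ((k + 1 : ℕ) : G)) (fun e r hr => by
      have h := defect_mem hπ hα (q := Fin.snoc (fun t => q t.castSucc) e)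
        (a := Fin.snoc (fun t => a t.castSucc) r) hy fun t => by
          refine Fin.lastCases ?_ (fun t => ?_) t
          · simpa using hr
          · simpa using ha t.castSucc
      rw [Fin.sum_univ_castSucc] at h
      simp only [Fin.snoc_castSucc, Fin.snoc_last] at h
      rw [curryLast_apply]
      convert h using 1
      abel_nf) (ha (Fin.last k))
  rw [Fin.sum_univ_castSucc]
  have e : p + ∑ t : Fin k, q t.castSucc - ((k + 1 : ℕ) : G) + q (Fin.last k)
      = p + (∑ t : Fin k, q t.castSucc + q (Fin.last k)) - ((k + 1 : ℕ) : G) := by abel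
  rw [e] at h
  exact h

theorem formalityMap_mem (hπ : ∀ p, ∀ y ∈ N.deg p, π y ∈ M.deg p)
    (hα : ∀ p, ∀ y ∈ N.deg p, α y ∈ M.deg (p + (d - 1))) (k : ℕ) (p : G)
    (q : Fin k → G) (y : N.carrier) (a : Fin k → K[X]) (hy : y ∈ N.deg p)
    (ha : ∀ t, a t ∈ polyGrading K d (q t)) :
    formalityMap M N π α k y a ∈ M.deg (p + ∑ t, q t - (k : G)) := by
  have h := hπ _ _ (evalLast_m_mem (SetLike.GradedOne.one_mem (A := polyGrading K d)) hy ha)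
  rw [add_zero] at h
  rcases k with _ | k
  · exact h
  · exact Submodule.sub_mem _ (zsmul_mem h _) (correction_mem hπ hα hy ha)

/-- The morphism of `A∞`-modules `N → M` determined by a homogeneous linear map `π` that kills
boundaries and a homotopy `α` for its linearity over `u`. -/
def formalityHom (hπ : ∀ p, ∀ y ∈ N.deg p, π y ∈ M.deg p)
    (hα : ∀ p, ∀ y ∈ N.deg p, α y ∈ M.deg (p + (d - 1))) (hπd : ∀ y, π (N.d y) = 0)
    (hαd : ∀ y, π (N.act Polynomial.X y) - M.rmul Polynomial.X (π y) = α (N.d y)) :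
    AInfHom N M.toAInf where
  f := formalityMap M N π α
  f_mem := formalityMap_mem hπ hα
  rel k y a := (barDiff_formalityMap hαd hπd k y a).trans
    (M.sum_ops (fun k => formalityMap M N π α k y (fun t => a t)) k a).symm

/-- An isomorphism `H(N) ≅ M` lifts to a homogeneous linear map `π : N → M` given by the class of a
cocycle on cocycles, and `π` is linear over `u` up to a homogeneous homotopy `α`. -/
theorem exists_linear_data (h : M.IsoCohomology N) :
    ∃ (e : N.Cohomology ≃ₗ[K] M.carrier) (π α : N.carrier →ₗ[K] M.carrier),
      (∀ h a, e (N.cohAct a h) = M.rmul a (e h)) ∧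
      (∀ z : LinearMap.ker N.d, π z = e (Submodule.Quotient.mk z)) ∧
      (∀ p, ∀ y ∈ N.deg p, π y ∈ M.deg p) ∧
      (∀ p, ∀ y ∈ N.deg p, α y ∈ M.deg (p + (d - 1))) ∧
      (∀ y, π (N.d y) = 0) ∧
      ∀ y, π (N.act Polynomial.X y) - M.rmul Polynomial.X (π y) = α (N.d y) := by
  obtain ⟨e, he, hact⟩ := h
  have hd : ∀ p, ∀ y ∈ N.deg p, N.d y ∈ N.deg (p + 1) := fun p y hy => by
    have h := N.m_mem 0 p Fin.elim0 y Fin.elim0 hy fun t => t.elim0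
    rwa [Finset.univ_eq_empty, Finset.sum_empty, add_zero, Nat.cast_zero, sub_zero] at h
  have hX : ∀ p, ∀ y ∈ N.deg p, N.act Polynomial.X y ∈ N.deg (p + d) := fun p y hy => by
    have h := N.m_mem 1 p (fun _ => d) y (fun _ => Polynomial.X) hy fun _ => X_mem_polyGrading
    rwa [Fin.sum_univ_one, Nat.cast_one, sub_self, add_zero] at h
  obtain ⟨π₀, hπ₀⟩ := LinearMap.exists_extend (e.toLinearMap ∘ₗ
    ((LinearMap.range N.d).submoduleOf (LinearMap.ker N.d)).mkQ)
  replace hπ₀ : ∀ z : LinearMap.ker N.d, π₀ z = e (Submodule.Quotient.mk z) :=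
    fun z => LinearMap.congr_fun hπ₀ z
  obtain ⟨π, hπ, hππ₀⟩ := N.isInternal.exists_homogeneous M.isInternal π₀ 0
  simp only [add_zero] at hπ hππ₀
  -- The graded components of a cocycle are cocycles, and `π₀` has degree `0` on homogeneous ones.
  have hπe : ∀ z : LinearMap.ker N.d, π z = e (Submodule.Quotient.mk z) := by
    intro z
    rw [← hπ₀]
    refine (N.isInternal.ker_le_iSup N.isInternal hd).trans
      (iSup_le (a := LinearMap.eqLocus π π₀) fun p => ?_) z.2
    rintro y ⟨hy, hyp⟩
    refine hππ₀ p y hyp ?_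
    rw [hπ₀ ⟨y, hy⟩, ← he]
    exact ⟨_, ⟨⟨y, hy⟩, hyp, rfl⟩, rfl⟩
  have hπd : ∀ y, π (N.d y) = 0 := fun y => by
    have h0 : (Submodule.Quotient.mk ⟨N.d y, N.d_d y⟩ : N.Cohomology) = 0 :=
      (Submodule.Quotient.mk_eq_zero _).2 ⟨y, rfl⟩
    rw [hπe ⟨N.d y, N.d_d y⟩, h0, map_zero]
  -- On cocycles `π` is linear over `u`, so its failure to be so factors through the differential.
  obtain ⟨α₀, hα₀⟩ := LinearMap.exists_comp_eq_of_ker_le N.d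
    (π ∘ₗ N.act Polynomial.X - M.rmul Polynomial.X ∘ₗ π) (by
      intro y hy
      have h1 := hact (Submodule.Quotient.mk ⟨y, hy⟩) Polynomial.X
      have hy' : N.d (N.act Polynomial.X y) = 0 := by
        rw [N.d_act, LinearMap.mem_ker.1 hy, map_zero]
      rw [LinearMap.mem_ker, LinearMap.sub_apply, LinearMap.comp_apply, LinearMap.comp_apply,
        hπe ⟨y, hy⟩, hπe ⟨_, hy'⟩, sub_eq_zero]
      exact h1)
  -- `u` has degree `d` and the differential degree `1`, so the homotopy has degree `d - 1`.
  obtain ⟨α, hα, hαα₀⟩ := N.isInternal.exists_homogeneous M.isInternal α₀ (d - 1)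
  refine ⟨e, π, α, fun h a => hact h a, hπe, hπ, hα, hπd, fun y => ?_⟩
  suffices H : π ∘ₗ N.act Polynomial.X - M.rmul Polynomial.X ∘ₗ π = α ∘ₗ N.d from
    LinearMap.congr_fun H y
  have htop : (⊤ : Submodule K N.carrier) ≤ LinearMap.eqLocus
      (π ∘ₗ N.act Polynomial.X - M.rmul Polynomial.X ∘ₗ π) (α ∘ₗ N.d) := by
    rw [← N.isInternal.submodule_iSup_eq_top]
    refine iSup_le fun p y hy => ?_
    have hmem : α₀ (N.d y) ∈ M.deg (p + 1 + (d - 1)) := by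
      rw [hα₀, show p + 1 + (d - 1) = p + d by abel]
      exact Submodule.sub_mem _ (hπ _ _ (hX p y hy)) (M.smul_mem (hπ p y hy) X_mem_polyGrading)
    exact ((hαα₀ _ _ (hd p y hy) hmem).trans (hα₀ y)).symm
  exact LinearMap.ext fun y => htop (Submodule.mem_top (x := y))

/-- Every graded right module over `K[u]` is intrinsically formal, for gradings by any commutative
group with a distinguished element `1`. -/
theorem intrinsicallyFormal (M : GradedRightModule.{v} (polyGrading K d)) :
    M.IntrinsicallyFormal.{v, w} := by
  intro N hN
  obtain ⟨e, π, α, hact, hπe, hπ, hα, hπd, hαd⟩ := exists_linear_data hN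
  let F := formalityHom hπ hα hπd hαd
  have hF : ∀ z : LinearMap.ker N.d, F.chainMap z = e (Submodule.Quotient.mk z) := by
    intro z
    have hz : N.d (N.act 1 z) = 0 := by rw [N.d_act, LinearMap.mem_ker.1 z.2, map_zero]
    -- `N` need not be strictly unital, but `1` acts as the identity on cohomology.
    have h1 : F.chainMap z = π (N.act 1 z) := formalityMap_zero M N π α z Fin.elim0
    rw [h1, hπe ⟨_, hz⟩]
    exact (hact (Submodule.Quotient.mk z) 1).trans (M.rmul_one _)
  have hd0 : ∀ x, M.toAInf.d x = 0 := fun x => rfl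
  refine ⟨F, (injective_iff_map_eq_zero _).2 fun h => ?_, fun h => ?_⟩
  · obtain ⟨z, rfl⟩ := Submodule.Quotient.mk_surjective _ h
    intro hz
    obtain ⟨x, hx⟩ := (Submodule.Quotient.mk_eq_zero _).1 hz
    have hx' : F.chainMap z = 0 := hx.symm.trans (hd0 x)
    rw [hF] at hx'
    exact (LinearEquiv.map_eq_zero_iff e).1 hx'
  · obtain ⟨x, rfl⟩ := Submodule.Quotient.mk_surjective _ h
    obtain ⟨z, hz⟩ := Submodule.Quotient.mk_surjective _ (e.symm x.1)
    refine ⟨Submodule.Quotient.mk z, ?_⟩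
    refine congrArg Submodule.Quotient.mk (Subtype.ext ?_)
    refine (hF z).trans ?_
    rw [hz]
    exact e.apply_symm_apply _

end GradedRightModule

end Formality

end

theorem mainTheorem9 (K : Type x) [Field K] (d : ℤ) :
    (∀ M : GradedRightModule.{v} (polyGrading K d), M.IntrinsicallyFormal.{v, w}) ∧
    (∀ M : GradedRightModule.{v} (polyGrading K (d : ZMod 2)),
      M.IntrinsicallyFormal.{v, w}) := by
  exact ⟨fun M => M.intrinsicallyFormal, fun M => M.intrinsicallyFormal⟩
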